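/- Let $d\ge 3$, let $m_d$ be Lebesgue measure on $\mathbb R^d$ and $\kappa_d=\pi^{d/2}/\Gamma(\tfrac d2+1)$ the volume of the unit ball. There is a constant $B>1$, depending only on $d$, such that the following holds for every sequence $(r_k)_{k\ge0}$ of positive numbers with $r_0=1$, $r_{k+1}<r_k/B$, $r_k/r_{k+1}\in\mathbb N$ and $1/r_k\in\mathbb N$ for all $k$, and $r_{k+1}/r_k\to0$. Construct finite sets of centers as follows. Generation $0$ consists of the origin. Given a center $z$ of generation $k$, choose $(r_k/r_{k+1})^{d-2}$ pairwise essentially disjoint closed axis-parallel cubes of side length $(\kappa_d\,r_{k+1}^{d-2}r_k^2)^{1/d}$ contained in the closed ball with center $z$ and radius $(1+\delta_{k+1})r_k$, where $\delta_{k+1}=\sqrt d\,\kappa_d^{1/d}(r_{k+1}/r_k)^{(d-2)/d}$; the centers of all cubes so obtained, over all $z$, form generation $k+1$. Let $$\mu^k=\sum_{z}\frac1{r_k^2}\,\chi_{\overline B(z,r_k)}\,m_d ,$$ the sum running over the centers $z$ of generation $k$. Such choices are possible and, for any such choices, some subsequence of $(\mu^k)$ converges weakly to a finite Borel measure. Let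 $\mu$ be any weak limit of a subsequence of $(\mu^k)$, for any such choices. Let $\alpha\in(0,1]$ and let $\Omega:\mathbb S^{d-1}\to\mathbb R$ be $\alpha$-Hölder continuous and not identically zero (no parity or mean-zero condition is imposed; in particular $\Omega$ may be odd or even). Then for $\mu$-almost every $x\in\mathbb R^d$ the limit $$\lim_{\varepsilon\to0^+}\int_{|x-y|>\varepsilon}\frac{\Omega\bigl(\frac{x-y}{|x-y|}\bigr)}{|x-y|^{d-2}}\,d\mu(y)$$ does not exist as a real number. -/

import Mathlib

open Filter Topology MeasureTheory
open scoped BoundedContinuousFunction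

noncomputable section

namespace CantorPV

/-- `ℝ^d` with its Euclidean norm and Lebesgue measure `volume`. -/
abbrev Space (d : ℕ) : Type := EuclideanSpace ℝ (Fin d)

/-- The volume `κ_d = π^{d/2} / Γ(d/2 + 1)` of the unit ball of `ℝ^d`. -/
def kappa (d : ℕ) : ℝ := Real.pi ^ ((d : ℝ) / 2) / Real.Gamma ((d : ℝ) / 2 + 1)

/-- The closed axis-parallel cube with centre `p` and side length `l`. -/
def cube {d : ℕ} (p : Space d) (l : ℝ) : Set (Space d) := {y | ∀ i, |y i - p i| ≤ l / 2}

/-- The side length `(κ_d ρ^{d-2} R^2)^{1/d}` of the cubes that are packed into a ball of radius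
about `R` and whose centres carry balls of radius `ρ`. -/
def side (d : ℕ) (R ρ : ℝ) : ℝ := (kappa d * ρ ^ (d - 2) * R ^ 2) ^ (1 / (d : ℝ))

/-- The relative enlargement `√d κ_d^{1/d} ((ρ / R)^{d-2})^{1/d}`. -/
def enlargement (d : ℕ) (R ρ : ℝ) : ℝ :=
  √(d : ℝ) * kappa d ^ (1 / (d : ℝ)) * ((ρ / R) ^ (d - 2)) ^ (1 / (d : ℝ))

/-- `S` is the set of centres of `(R / ρ)^{d-2}` pairwise essentially disjoint cubes of side length
`side d R ρ`, all contained in the enlargement by the factor `1 + enlargement d R ρ` of the ball of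
centre `z` and radius `R`. -/
structure IsPacking {d : ℕ} (z : Space d) (R ρ : ℝ) (S : Finset (Space d)) : Prop where
  card_eq : (S.card : ℝ) = (R / ρ) ^ (d - 2)
  essentially_disjoint : (S : Set (Space d)).Pairwise fun p q =>
    AEDisjoint volume (cube p (side d R ρ)) (cube q (side d R ρ))
  subset_ball : ∀ p ∈ S,
    cube p (side d R ρ) ⊆ Metric.closedBall z ((1 + enlargement d R ρ) * R)

/-- Radii `r_0 = 1 > r_1 > …` with `r_{k+1} < r_k / B` and `r_k / r_{k+1}`, `1 / r_k` integers. -/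
structure IsScaleSequence (B : ℝ) (r : ℕ → ℝ) : Prop where
  zero : r 0 = 1
  pos : ∀ k, 0 < r k
  lt_div : ∀ k, r (k + 1) < r k / B
  ratio_nat : ∀ k, ∃ N : ℕ, r k / r (k + 1) = N
  inv_nat : ∀ k, ∃ N : ℕ, 1 / r k = N

open scoped Classical in
/-- The centres of the balls of generation `k`: generation `0` is the origin, and each centre `z` of
generation `k` is replaced by the centres in `children k z`. -/
def centers {d : ℕ} (children : ℕ → Space d → Finset (Space d)) : ℕ → Finset (Space d)
  | 0 => {0}
  | k + 1 => (centers children k).biUnion (children k)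

/-- `children` encodes a choice of a packing by cubes for every ball of every generation. -/
def IsConstruction {d : ℕ} (r : ℕ → ℝ) (children : ℕ → Space d → Finset (Space d)) : Prop :=
  ∀ k, ∀ z ∈ centers children k, IsPacking z (r k) (r (k + 1)) (children k z)

/-- `μ^k`, the sum over the balls of generation `k`, of radius `r_k`, of Lebesgue measure restricted
to the ball and divided by `r_k^2`. -/
def approx {d : ℕ} (r : ℕ → ℝ) (children : ℕ → Space d → Finset (Space d)) (k : ℕ) :
    Measure (Space d) :=
  ∑ z ∈ centers children k,
    ENNReal.ofReal (1 / r k ^ 2) • volume.restrict (Metric.closedBall z (r k))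

/-- `μ` is a finite Borel measure that is the weak limit of a subsequence of the `μ^k`. -/
def IsLimitMeasure {d : ℕ} (r : ℕ → ℝ) (children : ℕ → Space d → Finset (Space d))
    (μ : Measure (Space d)) : Prop :=
  IsFiniteMeasure μ ∧ ∃ φ : ℕ → ℕ, StrictMono φ ∧ ∀ f : Space d →ᵇ ℝ,
    Tendsto (fun k => ∫ y, f y ∂(approx r children (φ k))) atTop (𝓝 (∫ y, f y ∂μ))

/-- Hölder continuity with exponent `α` of the restriction of `Ω` to the unit sphere; the values of
`Ω` off the sphere play no role. -/
def IsHolderOnSphere {d : ℕ} (α : ℝ) (Ω : Space d → ℝ) : Prop :=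
  ∃ C : ℝ, ∀ ω ∈ Metric.sphere (0 : Space d) 1, ∀ ξ ∈ Metric.sphere (0 : Space d) 1,
    |Ω ω - Ω ξ| ≤ C * ‖ω - ξ‖ ^ α

/-- The truncated integral of `Ω((x - y)/|x - y|) |x - y|^{-(d-2)} dμ(y)` over `|x - y| > ε`. -/
def truncated {d : ℕ} (Ω : Space d → ℝ) (μ : Measure (Space d)) (x : Space d) (ε : ℝ) : ℝ :=
  ∫ y in {y | ε < ‖x - y‖}, Ω (‖x - y‖⁻¹ • (x - y)) / ‖x - y‖ ^ (d - 2) ∂μ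

end CantorPV

end

/-!
Near a typical point the limit measure `μ` looks, at the scale of the radius `r k`, like
normalized Lebesgue measure on a ball of that radius: the cubes of generation `k + 1` almost
exhaust the ball (`IsPacking.le_card_filter`), while different balls of generation `k` are at
least `20 r k` apart (`IsConstruction.le_norm_sub`). A homogeneous kernel cannot cancel on such a
ball at every position.

Let `Ω ω₀ > 0` (otherwise replace `Ω` by `-Ω`), and suppose that `x` lies near the pole `z + R ω₀`
of its ball, of centre `z` and radius `R = r k`. The points of that ball at distance more than `(2
- 7 η) R` from `x` lie near the opposite pole by the parallelogram law, so they are seen from `x`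
in directions `(x - y) / |x - y|` close to `ω₀`, where `Ω` is bounded below by a positive
constant. They carry a definite proportion of the mass `κ_d R ^ (d - 2)` of the ball, and no other
mass lies within distance `5 R`. Hence the truncated integrals for the radii `(2 - 7 η) R` and `5
R` differ by at least a positive constant independent of `k`
(`IsLimitMeasure.le_truncated_sub_truncated`). No cancellation of `Ω` matters, as only one small
cap of directions contributes.

Almost every `x` is in this position for infinitely many `k` (`IsLimitMeasure.ae_frequently`): the
proportion of children near the pole is bounded below, so the points that avoid it in `n`
consecutive generations have mass at most `κ_d (1 - c) ^ n`. The truncated integrals therefore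
fail the Cauchy criterion.

All information on `μ` comes from one observation: the integral against `μ^j` of a function that
is constant on each cell of generation `k` does not depend on `j ≥ k`, so it passes to the weak
limit (`IsLimitMeasure.integral_eq`). It yields the exact mass of each cell and the fact that the
cells carry `μ`. Packings exist because the grid cubes that meet a ball cover it, and limit
measures exist by Prokhorov's theorem.
-/

noncomputable section

namespace CantorPV

/-! ### Balls, cubes and their volumes -/

lemma kappa_pos (d : ℕ) : 0 < kappa d := by
  unfold kappa
  have : 0 < Real.Gamma ((d : ℝ) / 2 + 1) := Real.Gamma_pos_of_pos (by positivity)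
  positivity

lemma volume_closedBall {d : ℕ} (hd : 0 < d) (z : Space d) {R : ℝ} (hR : 0 ≤ R) :
    volume (Metric.closedBall z R) = ENNReal.ofReal (kappa d * R ^ d) := by
  have : Nonempty (Fin d) := ⟨⟨0, hd⟩⟩
  rw [EuclideanSpace.volume_closedBall, Fintype.card_fin, ← ENNReal.ofReal_pow hR,
    ← ENNReal.ofReal_mul (by positivity), mul_comm]
  congr 2
  unfold kappa
  rw [Real.sqrt_eq_rpow, ← Real.rpow_natCast, ← Real.rpow_mul Real.pi_pos.le]
  congr 2
  ring

lemma cube_eq_preimage {d : ℕ} (p : Space d) {l : ℝ} (hl : 0 ≤ l) :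
    cube p l = WithLp.ofLp ⁻¹' Metric.closedBall (WithLp.ofLp p) (l / 2) := by
  ext y
  simp only [cube, Set.mem_ofPred_eq, Set.mem_preimage, Metric.mem_closedBall]
  rw [dist_pi_le_iff (by positivity)]
  rfl

lemma measurableSet_cube {d : ℕ} (p : Space d) {l : ℝ} (hl : 0 ≤ l) :
    MeasurableSet (cube p l) := by
  rw [cube_eq_preimage p hl]
  exact (PiLp.volume_preserving_ofLp (Fin d)).measurable Metric.isClosed_closedBall.measurableSet

lemma volume_cube {d : ℕ} (p : Space d) {l : ℝ} (hl : 0 ≤ l) :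
    volume (cube p l) = ENNReal.ofReal (l ^ d) := by
  rw [cube_eq_preimage p hl, (PiLp.volume_preserving_ofLp (Fin d)).measure_preimage
    Metric.isClosed_closedBall.measurableSet.nullMeasurableSet,
    Real.volume_pi_closedBall _ (by positivity), Fintype.card_fin, mul_div_cancel₀ _ two_ne_zero]

lemma closedBall_subset_cube {d : ℕ} (p : Space d) (l : ℝ) :
    Metric.closedBall p (l / 2) ⊆ cube p l := by
  intro y hy i
  rw [Metric.mem_closedBall, dist_eq_norm] at hy
  exact (by simpa using PiLp.norm_apply_le (y - p) i : |y i - p i| ≤ ‖y - p‖).trans hy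

lemma norm_sub_le_of_mem_cube {d : ℕ} {p y : Space d} {l : ℝ} (hl : 0 ≤ l) (hy : y ∈ cube p l) :
    ‖y - p‖ ≤ √d * l / 2 := by
  rw [EuclideanSpace.norm_eq]
  calc √(∑ i, ‖(y - p) i‖ ^ 2) ≤ √(∑ _i : Fin d, (l / 2) ^ 2) := by
        gcongr with i
        simpa using hy i
    _ = √d * l / 2 := by
        rw [Finset.sum_const, Finset.card_univ, Fintype.card_fin, nsmul_eq_mul,
          Real.sqrt_mul (by positivity), Real.sqrt_sq (by positivity), mul_div_assoc]

/-- Two cubes of the same side whose centres are closer than the side overlap in a ball about the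
midpoint of the centres. -/
lemma le_norm_sub_of_aedisjoint_cube {d : ℕ} {p q : Space d} {l : ℝ}
    (h : AEDisjoint volume (cube p l) (cube q l)) : l ≤ ‖p - q‖ := by
  by_contra! hlt
  have hsub : Metric.ball (midpoint ℝ p q) ((l - ‖p - q‖) / 2) ⊆ cube p l ∩ cube q l := by
    intro y hy
    rw [Metric.mem_ball] at hy
    have h1 : dist (midpoint ℝ p q) p = ‖p - q‖ / 2 := by
      rw [dist_midpoint_left, dist_eq_norm, Real.norm_ofNat]; ring
    have h2 : dist (midpoint ℝ p q) q = ‖p - q‖ / 2 := by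
      rw [dist_midpoint_right, dist_eq_norm, Real.norm_ofNat]; ring
    refine ⟨closedBall_subset_cube p l ?_, closedBall_subset_cube q l ?_⟩ <;>
      rw [Metric.mem_closedBall]
    · linarith [dist_triangle y (midpoint ℝ p q) p]
    · linarith [dist_triangle y (midpoint ℝ p q) q]
  have hpos : 0 < volume (Metric.ball (midpoint ℝ p q) ((l - ‖p - q‖) / 2)) :=
    Metric.measure_ball_pos _ _ (by linarith)
  exact (hpos.trans_le (measure_mono hsub)).ne' h

lemma side_nonneg (d : ℕ) {R ρ : ℝ} (hρ : 0 ≤ ρ) : 0 ≤ side d R ρ := by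
  have := kappa_pos d
  unfold side
  positivity

lemma side_pow {d : ℕ} (hd : d ≠ 0) {R ρ : ℝ} (hρ : 0 ≤ ρ) :
    side d R ρ ^ d = kappa d * ρ ^ (d - 2) * R ^ 2 := by
  have := kappa_pos d
  unfold side
  rw [one_div]
  exact Real.rpow_inv_natCast_pow (by positivity) hd

lemma enlargement_nonneg (d : ℕ) {R ρ : ℝ} (hR : 0 ≤ R) (hρ : 0 ≤ ρ) :
    0 ≤ enlargement d R ρ := by
  have := kappa_pos d
  unfold enlargement
  positivity

lemma enlargement_pow {d : ℕ} (hd : d ≠ 0) {R ρ : ℝ} (hR : 0 ≤ R) (hρ : 0 ≤ ρ) :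
    enlargement d R ρ ^ d = √d ^ d * kappa d * (ρ / R) ^ (d - 2) := by
  have := kappa_pos d
  unfold enlargement
  rw [mul_pow, mul_pow, one_div, Real.rpow_inv_natCast_pow (by positivity) hd,
    Real.rpow_inv_natCast_pow (by positivity) hd]

/-- The enlargement of the ball is exactly the diameter of the cubes. -/
lemma enlargement_mul {d : ℕ} (hd : 2 ≤ d) {R ρ : ℝ} (hR : 0 < R) (hρ : 0 ≤ ρ) :
    enlargement d R ρ * R = √d * side d R ρ := by
  have h0 : d ≠ 0 := by omega
  refine (pow_left_inj₀ (mul_nonneg (enlargement_nonneg d hR.le hρ) hR.le)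
    (mul_nonneg (by positivity) (side_nonneg d hρ)) h0).1 ?_
  rw [mul_pow, mul_pow, enlargement_pow h0 hR.le hρ, side_pow h0 hρ, div_pow]
  have : R ^ d = R ^ (d - 2) * R ^ 2 := by rw [← pow_add]; congr 1; omega
  rw [this]
  field_simp

/-- The volumes of the cubes of a packing add up to the volume of the ball. -/
lemma pow_mul_side_pow {d : ℕ} (hd : 2 ≤ d) {R ρ : ℝ} (hρ : 0 < ρ) :
    (R / ρ) ^ (d - 2) * side d R ρ ^ d = kappa d * R ^ d := by
  have : R ^ d = R ^ (d - 2) * R ^ 2 := by rw [← pow_add]; congr 1; omega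
  rw [side_pow (by omega) hρ.le, this, div_pow]
  field_simp

/-! ### Packings by cubes -/

lemma side_pos (d : ℕ) {R ρ : ℝ} (hR : 0 < R) (hρ : 0 < ρ) : 0 < side d R ρ := by
  have := kappa_pos d
  unfold side
  positivity

/-- Distinct cubes of a grid overlap only in a hyperplane. -/
lemma aedisjoint_grid_cube {d : ℕ} (z : Space d) {l : ℝ} (hl : 0 < l) {n m : Fin d → ℤ}
    (hnm : n ≠ m) :
    AEDisjoint volume (cube (z + WithLp.toLp 2 fun i => l * n i) l)
      (cube (z + WithLp.toLp 2 fun i => l * m i) l) := by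
  obtain ⟨i, hi⟩ := Function.ne_iff.1 hnm
  wlog hlt : n i < m i generalizing n m
  · exact (this hnm.symm hi.symm (lt_of_le_of_ne (not_lt.1 hlt) hi.symm)).symm
  have hplane : volume (WithLp.ofLp ⁻¹' {y : Fin d → ℝ | y i = z i + l * n i + l / 2} :
      Set (Space d)) = 0 := by
    have h0 : volume {y : Fin d → ℝ | y i = z i + l * n i + l / 2} = 0 := by
      rw [volume_pi]
      exact Measure.pi_hyperplane _ _ _
    rw [(PiLp.volume_preserving_ofLp (Fin d)).measure_preimage (NullMeasurableSet.of_null h0), h0]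
  refine measure_mono_null (fun y hy => ?_) hplane
  have h1 := (abs_le.1 (hy.1 i)).2
  have h2 := (abs_le.1 (hy.2 i)).1
  have h3 : (n i : ℝ) + 1 ≤ m i := by exact_mod_cast hlt
  simp only [PiLp.add_apply] at h1 h2
  change y i = z i + l * n i + l / 2
  nlinarith

/-- The cubes of a grid of side `side d R ρ` that meet the ball cover it, so their number is at
least the quotient of the volumes, which is `(R / ρ) ^ (d - 2)`. -/
theorem exists_isPacking {d : ℕ} (hd : 2 ≤ d) (z : Space d) {R ρ : ℝ} (hR : 0 < R) (hρ : 0 < ρ)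
    (hN : ∃ N : ℕ, R / ρ = N) : ∃ S : Finset (Space d), IsPacking z R ρ S := by
  classical
  obtain ⟨N, hN⟩ := hN
  set l := side d R ρ with hldef
  have hl : 0 < l := side_pos d hR hρ
  let p : (Fin d → ℤ) → Space d := fun n => z + WithLp.toLp 2 fun i => l * n i
  have hpinj : Function.Injective p := by
    intro n m h
    ext i
    have hi : z i + l * n i = z i + l * m i := congrArg (fun y : Space d => y i) h
    have : (n i : ℝ) = m i := by
      have := add_left_cancel hi
      exact mul_left_cancel₀ hl.ne' this
    exact_mod_cast this
  obtain ⟨M, hM⟩ := exists_nat_ge (R / l + 1)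
  let G : Finset (Fin d → ℤ) := (Fintype.piFinset fun _ => Finset.Icc (-(M : ℤ)) M).filter
    fun n => (cube (p n) l ∩ Metric.closedBall z R).Nonempty
  have hcover : Metric.closedBall z R ⊆ ⋃ n ∈ G, cube (p n) l := by
    intro y hy
    set n : Fin d → ℤ := fun i => round ((y i - z i) / l)
    have hr (i : Fin d) : |y i - (z i + l * n i)| ≤ l / 2 := by
      have h := abs_sub_round ((y i - z i) / l)
      have e : y i - (z i + l * n i) = l * ((y i - z i) / l - n i) := by
        field_simp
        ring
      rw [e, abs_mul, abs_of_pos hl]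
      nlinarith
    have hyc : y ∈ cube (p n) l := hr
    refine Set.mem_biUnion (Finset.mem_filter.2 ⟨?_, ⟨y, hyc, hy⟩⟩) hyc
    rw [Fintype.mem_piFinset]
    intro i
    have h1 : |y i - z i| ≤ R := by
      rw [Metric.mem_closedBall, dist_eq_norm] at hy
      exact (by simpa using PiLp.norm_apply_le (y - z) i : |y i - z i| ≤ ‖y - z‖).trans hy
    have h2 : |(n i : ℝ)| ≤ M := by
      refine le_trans ?_ hM
      have h3 : l * |(n i : ℝ)| ≤ R + l := by
        have h4 := hr i
        rw [← abs_of_pos hl, ← abs_mul, abs_of_pos hl]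
        rw [abs_le] at h1 h4 ⊢
        constructor <;> linarith
      rw [div_add_one hl.ne', le_div_iff₀ hl]
      linarith
    rw [Finset.mem_Icc]
    rw [abs_le] at h2
    constructor
    · exact_mod_cast h2.1
    · exact_mod_cast h2.2
  have hcard : N ^ (d - 2) ≤ (G.image p).card := by
    rw [Finset.card_image_of_injective _ hpinj]
    have h1 : ENNReal.ofReal (kappa d * R ^ d) ≤ ENNReal.ofReal (G.card * l ^ d) := by
      rw [← volume_closedBall (by omega) z hR.le]
      calc volume (Metric.closedBall z R) ≤ volume (⋃ n ∈ G, cube (p n) l) := measure_mono hcover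
        _ ≤ ∑ n ∈ G, volume (cube (p n) l) := measure_biUnion_finset_le _ _
        _ = ENNReal.ofReal (G.card * l ^ d) := by
          simp_rw [volume_cube _ hl.le]
          rw [Finset.sum_const, nsmul_eq_mul, ENNReal.ofReal_mul (by positivity),
            ENNReal.ofReal_natCast]
    rw [ENNReal.ofReal_le_ofReal_iff (by positivity), ← pow_mul_side_pow hd hρ, hN] at h1
    exact_mod_cast le_of_mul_le_mul_right h1 (by positivity)
  obtain ⟨S, hS, hScard⟩ := Finset.exists_subset_card_eq hcard
  refine ⟨S, by rw [hScard, hN]; push_cast; rfl, ?_, ?_⟩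
  · intro a ha b hb hab
    obtain ⟨n, -, rfl⟩ := Finset.mem_image.1 (hS ha)
    obtain ⟨m, -, rfl⟩ := Finset.mem_image.1 (hS hb)
    exact aedisjoint_grid_cube z hl fun h => hab (h ▸ rfl)
  · intro a ha y hy
    obtain ⟨n, hn, rfl⟩ := Finset.mem_image.1 (hS ha)
    obtain ⟨y₀, hy₀, hy₀z⟩ := (Finset.mem_filter.1 hn).2
    have h1 := norm_sub_le_of_mem_cube hl.le hy
    have h2 := norm_sub_le_of_mem_cube hl.le hy₀
    rw [norm_sub_rev] at h2
    rw [Metric.mem_closedBall, dist_eq_norm] at hy₀z ⊢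
    have h3 := norm_add₃_le (a := y - p n) (b := p n - y₀) (c := y₀ - z)
    rw [show y - p n + (p n - y₀) + (y₀ - z) = y - z by abel] at h3
    rw [add_mul, enlargement_mul hd hR hρ.le, ← hldef]
    linarith

open scoped Classical in
/-- A packing by sufficiently small cubes is asymptotically equidistributed: since the cubes
almost exhaust the volume of the enlarged ball, those that meet a given small ball `A` make up at
least half of the fraction that corresponds to the volume of `A`. -/
theorem IsPacking.le_card_filter {d : ℕ} (hd : 2 ≤ d) {z w : Space d} {R ρ η : ℝ}
    {S : Finset (Space d)} (hS : IsPacking z R ρ S) (hR : 0 < R) (hρ : 0 < ρ)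
    (hw : ‖w‖ + η ≤ 1) (he : enlargement d R ρ ≤ η / 2)
    (he' : (1 + enlargement d R ρ) ^ d ≤ 1 + (η / 2) ^ d / 2) :
    (η / 2) ^ d / 2 * (R / ρ) ^ (d - 2) ≤
      ((S.filter fun p => p ∈ Metric.closedBall (z + R • w) (η * R)).card : ℝ) := by
  set l := side d R ρ with hldef
  set e := enlargement d R ρ with hedef
  have hl : 0 < l := side_pos d hR hρ
  have hel : e * R = √d * l := enlargement_mul hd hR hρ.le
  have he0 : 0 ≤ e := enlargement_nonneg d hR.le hρ.le
  have hη : 0 ≤ η := by linarith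
  have hκ := kappa_pos d
  set A := Metric.closedBall (z + R • w) (η / 2 * R) with hA
  set S₁ := S.filter fun p => Disjoint A (cube p l) with hS₁
  set S₂ := S.filter fun p => ¬ Disjoint A (cube p l) with hS₂
  have hS₂sub : S₂ ⊆ S.filter fun p => p ∈ Metric.closedBall (z + R • w) (η * R) := by
    intro p hp
    rw [hS₂, Finset.mem_filter, Set.not_disjoint_iff] at hp
    obtain ⟨hpS, y, hyA, hyp⟩ := hp
    refine Finset.mem_filter.2 ⟨hpS, ?_⟩
    have h1 := norm_sub_le_of_mem_cube hl.le hyp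
    rw [norm_sub_rev] at h1
    rw [hA, Metric.mem_closedBall, dist_eq_norm] at hyA
    rw [Metric.mem_closedBall, dist_eq_norm]
    have h2 := norm_sub_le_norm_sub_add_norm_sub p y (z + R • w)
    nlinarith
  have hdisj : AEDisjoint volume A (⋃ p ∈ S₁, cube p l) := by
    refine Disjoint.aedisjoint ?_
    rw [Set.disjoint_iUnion₂_right]
    exact fun p hp => (Finset.mem_filter.1 hp).2
  have hsub : A ∪ (⋃ p ∈ S₁, cube p l) ⊆ Metric.closedBall z ((1 + e) * R) := by
    refine Set.union_subset (Metric.closedBall_subset_closedBall' ?_) (Set.iUnion₂_subset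
      fun p hp => hS.subset_ball p (Finset.mem_filter.1 hp).1)
    rw [dist_eq_norm, add_sub_cancel_left, norm_smul, Real.norm_of_nonneg hR.le]
    nlinarith
  have hmeas : MeasurableSet (⋃ p ∈ S₁, cube p l) :=
    Finset.measurableSet_biUnion _ fun p _ => measurableSet_cube p hl.le
  -- Compare volumes: `A` and the cubes that miss it fit disjointly into the enlarged ball.
  have hvol : ENNReal.ofReal (kappa d * (η / 2 * R) ^ d + S₁.card * l ^ d) ≤
      ENNReal.ofReal (kappa d * ((1 + e) * R) ^ d) := by
    rw [← volume_closedBall (by omega) z (by positivity), ENNReal.ofReal_add (by positivity)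
      (by positivity), ← volume_closedBall (by omega) (z + R • w) (by positivity)]
    refine le_trans (le_of_eq ?_) (measure_mono hsub)
    rw [measure_union₀ hmeas.nullMeasurableSet hdisj, measure_biUnion_finset₀]
    · simp_rw [volume_cube _ hl.le]
      rw [Finset.sum_const, nsmul_eq_mul, ENNReal.ofReal_mul (by positivity),
        ENNReal.ofReal_natCast]
    · exact fun p hp q hq => hS.essentially_disjoint (Finset.mem_filter.1 hp).1
        (Finset.mem_filter.1 hq).1
    · exact fun p _ => (measurableSet_cube p hl.le).nullMeasurableSet
  rw [ENNReal.ofReal_le_ofReal_iff (by positivity)] at hvol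
  have hsum : (S₁.card : ℝ) + S₂.card = (R / ρ) ^ (d - 2) := by
    rw [← hS.card_eq]
    exact_mod_cast Finset.card_filter_add_card_filter_not _
  have hcard : (S₂.card : ℝ) ≤
      ((S.filter fun p => p ∈ Metric.closedBall (z + R • w) (η * R)).card : ℝ) := by
    exact_mod_cast Finset.card_le_card hS₂sub
  refine le_trans ?_ hcard
  have hV := pow_mul_side_pow (R := R) hd hρ
  rw [← hldef] at hV
  refine le_of_mul_le_mul_right ?_ (pow_pos hl d)
  have hS₁eq : (S₁.card : ℝ) = (R / ρ) ^ (d - 2) - S₂.card := by linarith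
  rw [hS₁eq, sub_mul, hV, mul_pow, mul_pow] at hvol
  rw [mul_assoc, hV]
  have := mul_le_mul_of_nonneg_left he' (by positivity : 0 ≤ kappa d * R ^ d)
  linarith

/-! ### The cells of the construction and their masses -/

/-- A lower bound for the ratio of consecutive radii that makes the side of the cubes at least `20`
times the radius of the balls about their centres, and the enlargements at most `1 / 2`. -/
def scaleBound (d : ℕ) : ℝ := 2 + 20 ^ d / kappa d + (2 * √d) ^ d * kappa d

lemma two_le_scaleBound (d : ℕ) : 2 ≤ scaleBound d := by
  have := kappa_pos d
  have h1 : 0 ≤ 20 ^ d / kappa d := by positivity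
  have h2 : 0 ≤ (2 * √d) ^ d * kappa d := by positivity
  unfold scaleBound
  linarith

lemma mul_le_side {d : ℕ} (hd : 2 ≤ d) {R ρ : ℝ} (hρ : 0 < ρ) (h : scaleBound d * ρ ≤ R) :
    20 * ρ ≤ side d R ρ := by
  have hκ := kappa_pos d
  have hB := two_le_scaleBound d
  refine (pow_le_pow_iff_left₀ (by positivity) (side_nonneg d hρ.le) (by omega : d ≠ 0)).1 ?_
  rw [side_pow (by omega) hρ.le]
  have h1 : 20 ^ d / kappa d ≤ scaleBound d := by
    have h2 : 0 ≤ (2 * √d) ^ d * kappa d := by positivity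
    unfold scaleBound
    linarith
  have h2 : 20 ^ d ≤ kappa d * scaleBound d ^ 2 := by
    rw [div_le_iff₀ hκ] at h1
    nlinarith [mul_nonneg hκ.le (by nlinarith : 0 ≤ scaleBound d ^ 2 - scaleBound d)]
  have e : ρ ^ d = ρ ^ (d - 2) * ρ ^ 2 := by rw [← pow_add]; congr 1; omega
  calc (20 * ρ) ^ d = 20 ^ d * (ρ ^ (d - 2) * ρ ^ 2) := by rw [mul_pow, e]
    _ ≤ kappa d * scaleBound d ^ 2 * (ρ ^ (d - 2) * ρ ^ 2) := by gcongr
    _ = kappa d * ρ ^ (d - 2) * (scaleBound d * ρ) ^ 2 := by ring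
    _ ≤ kappa d * ρ ^ (d - 2) * R ^ 2 := by gcongr

lemma enlargement_le_half {d : ℕ} (hd : 3 ≤ d) {R ρ : ℝ} (hρ : 0 < ρ)
    (h : scaleBound d * ρ ≤ R) : enlargement d R ρ ≤ 1 / 2 := by
  have hκ := kappa_pos d
  have hB := two_le_scaleBound d
  have hR : 0 < R := by nlinarith
  refine (pow_le_pow_iff_left₀ (enlargement_nonneg d hR.le hρ.le) (by positivity)
    (by omega : d ≠ 0)).1 ?_
  rw [enlargement_pow (by omega) hR.le hρ.le]
  have h1 : (2 * √d) ^ d * kappa d ≤ scaleBound d := by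
    have h2 : 0 ≤ 20 ^ d / kappa d := by positivity
    unfold scaleBound
    linarith
  have h2 : (ρ / R) ^ (d - 2) ≤ ρ / R :=
    pow_le_of_le_one (by positivity) ((div_le_one hR).2 (by nlinarith)) (by omega)
  have h3 : ρ / R * scaleBound d ≤ 1 := by
    rw [div_mul_eq_mul_div, div_le_one hR]
    linarith
  rw [one_div, inv_pow, ← one_div, le_div_iff₀ (by positivity)]
  calc √d ^ d * kappa d * (ρ / R) ^ (d - 2) * 2 ^ d
      = (2 * √d) ^ d * kappa d * (ρ / R) ^ (d - 2) := by rw [mul_pow]; ring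
    _ ≤ scaleBound d * (ρ / R) := by gcongr
    _ ≤ 1 := by linarith

/-- The ball of twice the radius about a centre of generation `k`; it carries all of the mass of the
limit measure that descends from that centre. -/
def cell {d : ℕ} (r : ℕ → ℝ) (k : ℕ) (z : Space d) : Set (Space d) :=
  Metric.closedBall z (2 * r k)

lemma mem_cell {d : ℕ} {r : ℕ → ℝ} {k : ℕ} {z y : Space d} :
    y ∈ cell r k z ↔ ‖y - z‖ ≤ 2 * r k := by
  rw [cell, Metric.mem_closedBall, dist_eq_norm]

lemma mem_centers_succ {d : ℕ} {children : ℕ → Space d → Finset (Space d)} {k : ℕ} {p : Space d} :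
    p ∈ centers children (k + 1) ↔ ∃ z ∈ centers children k, p ∈ children k z := by
  simp [centers]

lemma IsScaleSequence.mul_le {d : ℕ} {r : ℕ → ℝ} (hr : IsScaleSequence (scaleBound d) r) (k : ℕ) :
    scaleBound d * r (k + 1) ≤ r k := by
  have h := hr.lt_div k
  rw [lt_div_iff₀ (by linarith [two_le_scaleBound d])] at h
  linarith

lemma IsScaleSequence.two_mul_le {d : ℕ} {r : ℕ → ℝ} (hr : IsScaleSequence (scaleBound d) r)
    (k : ℕ) : 2 * r (k + 1) ≤ r k :=
  (mul_le_mul_of_nonneg_right (two_le_scaleBound d) (hr.pos _).le).trans (hr.mul_le k)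

lemma IsScaleSequence.tendsto_zero {d : ℕ} {r : ℕ → ℝ} (hr : IsScaleSequence (scaleBound d) r) :
    Tendsto r atTop (𝓝 0) := by
  refine squeeze_zero (fun k => (hr.pos k).le) (g := fun k => (1 / 2 : ℝ) ^ k) (fun k => ?_)
    (tendsto_pow_atTop_nhds_zero_of_lt_one (by norm_num) (by norm_num))
  induction k with
  | zero => simp [hr.zero]
  | succ k ih => rw [pow_succ]; linarith [hr.two_mul_le k]

section Construction

variable {d : ℕ} {r : ℕ → ℝ} {children : ℕ → Space d → Finset (Space d)}

lemma IsConstruction.cell_subset_closedBall (hd : 3 ≤ d) (hr : IsScaleSequence (scaleBound d) r)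
    (hc : IsConstruction r children) {k : ℕ} {z p : Space d} (hz : z ∈ centers children k)
    (hp : p ∈ children k z) :
    cell r (k + 1) p ⊆ Metric.closedBall z ((1 + enlargement d (r k) (r (k + 1))) * r k) := by
  refine subset_trans ?_ ((hc k z hz).subset_ball p hp)
  refine subset_trans (Metric.closedBall_subset_closedBall ?_) (closedBall_subset_cube _ _)
  have := mul_le_side (d := d) (by omega) (hr.pos (k + 1)) (hr.mul_le k)
  linarith [hr.pos (k + 1)]

lemma IsConstruction.cell_subset_cell (hd : 3 ≤ d) (hr : IsScaleSequence (scaleBound d) r)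
    (hc : IsConstruction r children) {k : ℕ} {z p : Space d} (hz : z ∈ centers children k)
    (hp : p ∈ children k z) : cell r (k + 1) p ⊆ cell r k z := by
  refine (hc.cell_subset_closedBall hd hr hz hp).trans (Metric.closedBall_subset_closedBall ?_)
  have := enlargement_le_half hd (hr.pos (k + 1)) (hr.mul_le k)
  nlinarith [hr.pos k]

lemma IsConstruction.child_mem_cell (hd : 3 ≤ d) (hr : IsScaleSequence (scaleBound d) r)
    (hc : IsConstruction r children) {k : ℕ} {z p : Space d} (hz : z ∈ centers children k)
    (hp : p ∈ children k z) : p ∈ cell r k z :=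
  hc.cell_subset_cell hd hr hz hp (Metric.mem_closedBall_self (by linarith [hr.pos (k + 1)]))

/-- Centres of the same generation are far apart compared with the radius. -/
lemma IsConstruction.le_norm_sub (hd : 3 ≤ d) (hr : IsScaleSequence (scaleBound d) r)
    (hc : IsConstruction r children) (k : ℕ) {z z' : Space d} (hz : z ∈ centers children k)
    (hz' : z' ∈ centers children k) (hne : z ≠ z') : 20 * r k ≤ ‖z - z'‖ := by
  induction k generalizing z z' with
  | zero =>
    simp only [centers, Finset.mem_singleton] at hz hz'
    exact absurd (hz.trans hz'.symm) hne
  | succ k ih =>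
    obtain ⟨u, hu, hzu⟩ := mem_centers_succ.1 hz
    obtain ⟨u', hu', hzu'⟩ := mem_centers_succ.1 hz'
    by_cases h : u = u'
    · subst h
      exact (mul_le_side (by omega) (hr.pos _) (hr.mul_le k)).trans
        (le_norm_sub_of_aedisjoint_cube ((hc k u hu).essentially_disjoint hzu hzu' hne))
    · have h1 := ih hu hu' h
      have h2 := mem_cell.1 (hc.child_mem_cell hd hr hu hzu)
      have h3 := mem_cell.1 (hc.child_mem_cell hd hr hu' hzu')
      have h4 := norm_add₃_le (a := u - z) (b := z - z') (c := z' - u')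
      rw [show u - z + (z - z') + (z' - u') = u - u' by abel, norm_sub_rev u z] at h4
      linarith [hr.two_mul_le k, hr.pos k]

lemma IsConstruction.eq_of_mem_cell (hd : 3 ≤ d) (hr : IsScaleSequence (scaleBound d) r)
    (hc : IsConstruction r children) {k : ℕ} {z z' y : Space d} (hz : z ∈ centers children k)
    (hz' : z' ∈ centers children k) (hy : y ∈ cell r k z) (hy' : y ∈ cell r k z') : z = z' := by
  by_contra hne
  have h1 := hc.le_norm_sub hd hr k hz hz' hne
  rw [mem_cell] at hy hy'
  rw [norm_sub_rev] at hy
  have h2 := norm_sub_le_norm_sub_add_norm_sub z y z'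
  linarith [hr.pos k]

lemma IsConstruction.pairwiseDisjoint_children (hd : 3 ≤ d)
    (hr : IsScaleSequence (scaleBound d) r) (hc : IsConstruction r children) (k : ℕ) :
    (centers children k : Set (Space d)).PairwiseDisjoint (children k) := by
  intro z hz z' hz' hne
  refine Finset.disjoint_left.2 fun p hp hp' => hne ?_
  exact hc.eq_of_mem_cell hd hr hz hz' (hc.child_mem_cell hd hr hz hp)
    (hc.child_mem_cell hd hr hz' hp')

lemma IsConstruction.sum_centers_succ (hd : 3 ≤ d) (hr : IsScaleSequence (scaleBound d) r)
    (hc : IsConstruction r children) {k : ℕ} {f : Space d → ℝ}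
    (hf : ∀ z ∈ centers children k, ∀ y ∈ cell r k z, f y = f z) :
    r (k + 1) ^ (d - 2) * ∑ p ∈ centers children (k + 1), f p =
      r k ^ (d - 2) * ∑ z ∈ centers children k, f z := by
  classical
  have hbi : centers children (k + 1) = (centers children k).biUnion (children k) := by
    ext p
    rw [mem_centers_succ, Finset.mem_biUnion]
  rw [hbi, Finset.sum_biUnion (hc.pairwiseDisjoint_children hd hr k), Finset.mul_sum,
    Finset.mul_sum]
  refine Finset.sum_congr rfl fun z hz => ?_
  rw [Finset.sum_congr rfl fun p hp => hf z hz p (hc.child_mem_cell hd hr hz hp),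
    Finset.sum_const, nsmul_eq_mul, (hc k z hz).card_eq, div_pow]
  have := hr.pos (k + 1)
  field_simp

lemma IsConstruction.eq_on_cell_succ (hd : 3 ≤ d) (hr : IsScaleSequence (scaleBound d) r)
    (hc : IsConstruction r children) {k : ℕ} {f : Space d → ℝ}
    (hf : ∀ z ∈ centers children k, ∀ y ∈ cell r k z, f y = f z) :
    ∀ p ∈ centers children (k + 1), ∀ y ∈ cell r (k + 1) p, f y = f p := by
  intro p hp y hy
  obtain ⟨z, hz, hpz⟩ := mem_centers_succ.1 hp
  rw [hf z hz y (hc.cell_subset_cell hd hr hz hpz hy),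
    hf z hz p (hc.child_mem_cell hd hr hz hpz)]

lemma integral_approx (hd : 2 ≤ d) (hr : ∀ k, 0 < r k) {k : ℕ} (f : Space d →ᵇ ℝ)
    (hf : ∀ z ∈ centers children k, ∀ y ∈ cell r k z, f y = f z) :
    ∫ y, f y ∂(approx r children k) =
      kappa d * (r k ^ (d - 2) * ∑ z ∈ centers children k, f z) := by
  have hint (z : Space d) : Integrable (fun y => f y)
      (ENNReal.ofReal (1 / r k ^ 2) • volume.restrict (Metric.closedBall z (r k))) := by
    have : IsFiniteMeasure (volume.restrict (Metric.closedBall z (r k))) :=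
      ⟨by simpa using measure_closedBall_lt_top⟩
    exact (f.integrable _).smul_measure ENNReal.ofReal_ne_top
  have hk := hr k
  have hκ := kappa_pos d
  rw [approx, integral_finsetSum_measure fun z _ => hint z, Finset.mul_sum, Finset.mul_sum]
  refine Finset.sum_congr rfl fun z hz => ?_
  rw [integral_smul_measure, setIntegral_congr_fun Metric.isClosed_closedBall.measurableSet
    (g := fun _ => f z), setIntegral_const, Measure.real, volume_closedBall (by omega) z hk.le,
    ENNReal.toReal_ofReal (by positivity), ENNReal.toReal_ofReal (by positivity), smul_eq_mul,
    smul_eq_mul]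
  · have : r k ^ d = r k ^ (d - 2) * r k ^ 2 := by rw [← pow_add]; congr 1; omega
    rw [this]
    field_simp
  · exact fun y hy => hf z hz y (Metric.closedBall_subset_closedBall (by linarith) hy)

/-- The mass of a cell does not change in later generations, so integrals of functions that are
constant on the cells do not change either. -/
lemma IsConstruction.integral_approx_of_le (hd : 3 ≤ d) (hr : IsScaleSequence (scaleBound d) r)
    (hc : IsConstruction r children) {k : ℕ} (f : Space d →ᵇ ℝ)
    (hf : ∀ z ∈ centers children k, ∀ y ∈ cell r k z, f y = f z) {j : ℕ} (hj : k ≤ j) :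
    ∫ y, f y ∂(approx r children j) =
      kappa d * (r k ^ (d - 2) * ∑ z ∈ centers children k, f z) := by
  have key : (∀ z ∈ centers children j, ∀ y ∈ cell r j z, f y = f z) ∧
      r j ^ (d - 2) * ∑ z ∈ centers children j, f z =
        r k ^ (d - 2) * ∑ z ∈ centers children k, f z := by
    induction j, hj using Nat.le_induction with
    | base => exact ⟨hf, rfl⟩
    | succ j _ ih =>
      exact ⟨hc.eq_on_cell_succ hd hr ih.1, (hc.sum_centers_succ hd hr ih.1).trans ih.2⟩
  rw [integral_approx (by omega) hr.pos f key.1, key.2]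

lemma IsConstruction.card_centers (hd : 3 ≤ d) (hr : IsScaleSequence (scaleBound d) r)
    (hc : IsConstruction r children) (k : ℕ) :
    r k ^ (d - 2) * ((centers children k).card : ℝ) = 1 := by
  induction k with
  | zero => simp [centers, hr.zero]
  | succ k ih =>
    have := hc.sum_centers_succ hd hr (k := k) (f := fun _ => 1) fun _ _ _ _ => rfl
    simp only [Finset.sum_const, nsmul_eq_mul, mul_one] at this
    rw [this, ih]

lemma IsLimitMeasure.integral_eq (hd : 3 ≤ d) (hr : IsScaleSequence (scaleBound d) r)
    (hc : IsConstruction r children) {μ : Measure (Space d)} (hμ : IsLimitMeasure r children μ)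
    {k : ℕ} (f : Space d →ᵇ ℝ)
    (hf : ∀ z ∈ centers children k, ∀ y ∈ cell r k z, f y = f z) :
    ∫ y, f y ∂μ = kappa d * (r k ^ (d - 2) * ∑ z ∈ centers children k, f z) := by
  obtain ⟨-, φ, hφ, hlim⟩ := hμ
  refine tendsto_nhds_unique (hlim f) (tendsto_const_nhds.congr' ?_)
  filter_upwards [eventually_ge_atTop k] with j hj
  exact (hc.integral_approx_of_le hd hr f hf (hj.trans hφ.le_apply)).symm

/-- The union of the cells of generation `k`. -/
def cells (r : ℕ → ℝ) (children : ℕ → Space d → Finset (Space d)) (k : ℕ) : Set (Space d) :=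
  ⋃ z ∈ centers children k, cell r k z

lemma isClosed_cells (k : ℕ) : IsClosed (cells r children k) :=
  isClosed_biUnion_finset fun _ _ => Metric.isClosed_closedBall

lemma IsConstruction.centers_nonempty (hd : 3 ≤ d) (hr : IsScaleSequence (scaleBound d) r)
    (hc : IsConstruction r children) (k : ℕ) : (centers children k).Nonempty := by
  have h := hc.card_centers hd hr k
  rw [Finset.nonempty_iff_ne_empty]
  rintro h0
  simp [h0] at h

/-- The integral of the truncated distance to the union of the cells vanishes. -/
lemma IsLimitMeasure.ae_mem_cells (hd : 3 ≤ d) (hr : IsScaleSequence (scaleBound d) r)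
    (hc : IsConstruction r children) {μ : Measure (Space d)} (hμ : IsLimitMeasure r children μ)
    (k : ℕ) : ∀ᵐ x ∂μ, x ∈ cells r children k := by
  have : IsFiniteMeasure μ := hμ.1
  have hne : (cells r children k).Nonempty := by
    obtain ⟨z, hz⟩ := hc.centers_nonempty hd hr k
    exact ⟨z, Set.mem_biUnion hz (mem_cell.2 (by simp [(hr.pos k).le]))⟩
  let f : Space d →ᵇ ℝ := BoundedContinuousFunction.ofNormedAddCommGroup
    (fun y => min 1 (Metric.infDist y (cells r children k)))
    (continuous_const.min (Metric.continuous_infDist_pt _)) 1 (fun y => by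
      rw [Real.norm_of_nonneg (le_min zero_le_one Metric.infDist_nonneg)]
      exact min_le_left _ _)
  have hf0 (y : Space d) (hy : y ∈ cells r children k) : f y = 0 := by
    change min 1 (Metric.infDist y (cells r children k)) = 0
    rw [Metric.infDist_zero_of_mem hy]
    simp
  have hf1 (z) (hz : z ∈ centers children k) (y) (hy : y ∈ cell r k z) : f y = 0 :=
    hf0 y (Set.mem_biUnion hz hy)
  have hf2 (z) (hz : z ∈ centers children k) : f z = 0 :=
    hf1 z hz z (mem_cell.2 (by simp [(hr.pos k).le]))
  have hint := hμ.integral_eq hd hr hc f (k := k) fun z hz y hy => by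
    rw [hf1 z hz y hy, hf2 z hz]
  rw [Finset.sum_eq_zero hf2, mul_zero, mul_zero, integral_eq_zero_iff_of_nonneg
    (f := fun y => f y) (fun y => le_min zero_le_one Metric.infDist_nonneg) (f.integrable μ)] at hint
  filter_upwards [hint] with x hx
  have hx' : min 1 (Metric.infDist x (cells r children k)) = 0 := hx
  rw [(isClosed_cells k).mem_iff_infDist_zero hne]
  rcases min_choice 1 (Metric.infDist x (cells r children k)) with h | h <;> rw [h] at hx'
  · exact absurd hx' one_ne_zero
  · exact hx'

/-- Test with a bump function that equals `1` on the cell and `0` on the other cells. -/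
lemma IsLimitMeasure.measure_cell (hd : 3 ≤ d) (hr : IsScaleSequence (scaleBound d) r)
    (hc : IsConstruction r children) {μ : Measure (Space d)} (hμ : IsLimitMeasure r children μ)
    {k : ℕ} {z : Space d} (hz : z ∈ centers children k) :
    μ.real (cell r k z) = kappa d * r k ^ (d - 2) := by
  have : IsFiniteMeasure μ := hμ.1
  have hk := hr.pos k
  let g : Space d → ℝ := fun y => max 0 (min 1 (3 - ‖y - z‖ / r k))
  let f : Space d →ᵇ ℝ := BoundedContinuousFunction.ofNormedAddCommGroup g
    (by fun_prop) 1 (fun y => by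
      rw [Real.norm_of_nonneg (le_max_left _ _)]
      exact max_le zero_le_one (min_le_left _ _))
  have hf1 (y) (hy : y ∈ cell r k z) : f y = 1 := by
    change max 0 (min 1 (3 - ‖y - z‖ / r k)) = 1
    have : ‖y - z‖ / r k ≤ 2 := (div_le_iff₀ hk).2 (mem_cell.1 hy)
    rw [min_eq_left (by linarith), max_eq_right zero_le_one]
  have hf0 (z') (hz' : z' ∈ centers children k) (hne : z' ≠ z) (y) (hy : y ∈ cell r k z') :
      f y = 0 := by
    change max 0 (min 1 (3 - ‖y - z‖ / r k)) = 0
    have h1 := hc.le_norm_sub hd hr k hz' hz hne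
    have h2 := mem_cell.1 hy
    rw [norm_sub_rev] at h2
    have h3 := norm_sub_le_norm_sub_add_norm_sub z' y z
    have : 3 ≤ ‖y - z‖ / r k := (le_div_iff₀ hk).2 (by linarith)
    exact max_eq_left ((min_le_right _ _).trans (by linarith))
  have hself (z' : Space d) : z' ∈ cell r k z' := mem_cell.2 (by simp [hk.le])
  have hint := hμ.integral_eq hd hr hc f (k := k) fun z' hz' y hy => by
    by_cases h : z' = z
    · subst h
      rw [hf1 y hy, hf1 z' (hself z')]
    · rw [hf0 z' hz' h y hy, hf0 z' hz' h z' (hself z')]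
  rw [Finset.sum_eq_single_of_mem z hz fun z' hz' h => hf0 z' hz' h z' (hself z'),
    hf1 z (hself z), mul_one] at hint
  rw [← hint, ← integral_indicator_one (s := cell r k z) Metric.isClosed_closedBall.measurableSet]
  refine integral_congr_ae ?_
  filter_upwards [hμ.ae_mem_cells hd hr hc k] with x hx
  by_cases hxz : x ∈ cell r k z
  · rw [hf1 x hxz]
    exact Set.indicator_of_mem hxz _
  · obtain ⟨z', hz', hxz'⟩ := Set.mem_iUnion₂.1 hx
    rw [hf0 z' hz' (fun h => hxz (h ▸ hxz')) x hxz']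
    exact Set.indicator_of_notMem hxz _

end Construction

/-! ### Existence of limit measures and recurrence of relative positions -/

theorem exists_isConstruction {d : ℕ} (hd : 2 ≤ d) {B : ℝ} {r : ℕ → ℝ}
    (hr : IsScaleSequence B r) :
    ∃ children : ℕ → Space d → Finset (Space d), IsConstruction r children := by
  choose S hS using fun (k : ℕ) (z : Space d) =>
    exists_isPacking hd z (hr.pos k) (hr.pos (k + 1)) (hr.ratio_nat k)
  exact ⟨S, fun k z _ => hS k z⟩

section Limit

variable {d : ℕ} {r : ℕ → ℝ} {children : ℕ → Space d → Finset (Space d)}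

lemma IsConstruction.cell_subset_closedBall_zero (hd : 3 ≤ d)
    (hr : IsScaleSequence (scaleBound d) r) (hc : IsConstruction r children) (k : ℕ)
    {z : Space d} (hz : z ∈ centers children k) :
    cell r k z ⊆ Metric.closedBall 0 2 := by
  induction k generalizing z with
  | zero =>
    obtain rfl : z = 0 := by simpa [centers] using hz
    rw [cell, hr.zero, mul_one]
  | succ k ih =>
    obtain ⟨u, hu, hzu⟩ := mem_centers_succ.1 hz
    exact (hc.cell_subset_cell hd hr hu hzu).trans (ih hu)

lemma IsConstruction.approx_univ (hd : 3 ≤ d) (hr : IsScaleSequence (scaleBound d) r)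
    (hc : IsConstruction r children) (k : ℕ) :
    approx r children k Set.univ = ENNReal.ofReal (kappa d) := by
  have hk := hr.pos k
  have hκ := kappa_pos d
  have e : r k ^ d = r k ^ (d - 2) * r k ^ 2 := by rw [← pow_add]; congr 1; omega
  rw [approx, Measure.finsetSum_apply]
  simp only [Measure.smul_apply, Measure.restrict_apply_univ, smul_eq_mul,
    volume_closedBall (show 0 < d by omega) _ hk.le, ← ENNReal.ofReal_mul
      (show 0 ≤ 1 / r k ^ 2 by positivity)]
  rw [Finset.sum_const, nsmul_eq_mul, ← ENNReal.ofReal_natCast,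
    ← ENNReal.ofReal_mul (by positivity)]
  congr 1
  calc ((centers children k).card : ℝ) * (1 / r k ^ 2 * (kappa d * r k ^ d))
      = kappa d * (r k ^ (d - 2) * ((centers children k).card : ℝ)) := by
        rw [e]
        field_simp
    _ = kappa d := by rw [hc.card_centers hd hr k, mul_one]

lemma IsConstruction.approx_compl_closedBall (hd : 3 ≤ d) (hr : IsScaleSequence (scaleBound d) r)
    (hc : IsConstruction r children) (k : ℕ) :
    approx r children k (Metric.closedBall 0 2)ᶜ = 0 := by
  rw [approx, Measure.finsetSum_apply]
  refine Finset.sum_eq_zero fun z hz => ?_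
  rw [Measure.smul_apply, Measure.restrict_apply Metric.isClosed_closedBall.measurableSet.compl,
    Set.disjoint_iff_inter_eq_empty.1, measure_empty, smul_zero]
  refine (Set.disjoint_compl_left_iff_subset).2 (subset_trans ?_
    (hc.cell_subset_closedBall_zero hd hr k hz))
  exact Metric.closedBall_subset_closedBall (by linarith [hr.pos k])

/-- Apply Prokhorov's theorem to the normalized measures, which live on a common compact ball. -/
theorem IsConstruction.exists_isLimitMeasure (hd : 3 ≤ d) (hr : IsScaleSequence (scaleBound d) r)
    (hc : IsConstruction r children) : ∃ μ : Measure (Space d), IsLimitMeasure r children μ := by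
  have hκ := kappa_pos d
  have hκ0 : ENNReal.ofReal (kappa d) ≠ 0 := (ENNReal.ofReal_pos.2 hκ).ne'
  have hprob (k : ℕ) :
      IsProbabilityMeasure ((ENNReal.ofReal (kappa d))⁻¹ • approx r children k) := by
    refine ⟨?_⟩
    rw [Measure.smul_apply, hc.approx_univ hd hr k, smul_eq_mul,
      ENNReal.inv_mul_cancel hκ0 ENNReal.ofReal_ne_top]
  let P : ℕ → ProbabilityMeasure (Space d) := fun k => ⟨_, hprob k⟩
  have htight : IsTightMeasureSet
      {((ν : ProbabilityMeasure (Space d)) : Measure (Space d)) | ν ∈ Set.range P} := by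
    rw [isTightMeasureSet_iff_exists_isCompact_measure_compl_le]
    refine fun ε _ => ⟨Metric.closedBall 0 2, isCompact_closedBall _ _, ?_⟩
    rintro _ ⟨_, ⟨k, rfl⟩, rfl⟩
    change ((ENNReal.ofReal (kappa d))⁻¹ • approx r children k) _ ≤ ε
    rw [Measure.smul_apply, hc.approx_compl_closedBall hd hr k, smul_zero]
    exact zero_le
  obtain ⟨Q, -, φ, hφ, hQ⟩ := (isCompact_closure_of_isTightMeasureSet htight).tendsto_subseq
    fun k => subset_closure (Set.mem_range_self k)
  rw [ProbabilityMeasure.tendsto_iff_forall_integral_tendsto] at hQ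
  refine ⟨ENNReal.ofReal (kappa d) • (Q : Measure (Space d)), ?_, φ, hφ, fun f => ?_⟩
  · exact Measure.smul_finite _ ENNReal.ofReal_ne_top
  · rw [integral_smul_measure]
    refine ((hQ f).const_smul (ENNReal.ofReal (kappa d)).toReal).congr fun k => ?_
    change _ • ∫ y, f y ∂((ENNReal.ofReal (kappa d))⁻¹ • approx r children (φ k)) = _
    rw [← integral_smul_measure, smul_smul, ENNReal.mul_inv_cancel hκ0 ENNReal.ofReal_ne_top,
      one_smul]

lemma tendsto_enlargement (hd : 3 ≤ d) (h : Tendsto (fun n => r (n + 1) / r n) atTop (𝓝 0)) :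
    Tendsto (fun k => enlargement d (r k) (r (k + 1))) atTop (𝓝 0) := by
  have h1 : Tendsto (fun k => ((r (k + 1) / r k) ^ (d - 2)) ^ (1 / (d : ℝ))) atTop (𝓝 0) := by
    have h2 := (h.pow (d - 2)).rpow_const (p := 1 / (d : ℝ)) (Or.inr (by positivity))
    have : (1 / (d : ℝ)) ≠ 0 := by
      have : (d : ℝ) ≠ 0 := by exact_mod_cast (by omega : d ≠ 0)
      positivity
    rwa [zero_pow (by omega), Real.zero_rpow this] at h2
  simpa [enlargement] using h1.const_mul (√(d : ℝ) * kappa d ^ (1 / (d : ℝ)))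

open scoped Classical in
/-- The children of `z` whose centres lie in the ball with centre `z + R w` and radius `η R`, where
`R` is the radius of the ball about `z`. -/
def childrenNear (r : ℕ → ℝ) (children : ℕ → Space d → Finset (Space d)) (w : Space d) (η : ℝ)
    (k : ℕ) (z : Space d) : Finset (Space d) :=
  (children k z).filter fun p => p ∈ Metric.closedBall (z + r k • w) (η * r k)

open scoped Classical in
lemma childrenNear_subset (w : Space d) (η : ℝ) (k : ℕ) (z : Space d) :
    childrenNear r children w η k z ⊆ children k z :=
  Finset.filter_subset _ _

open scoped Classical in
lemma norm_sub_le_of_mem_childrenNear {w : Space d} {η : ℝ} {k : ℕ} {z p : Space d}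
    (hp : p ∈ childrenNear r children w η k z) : ‖p - (z + r k • w)‖ ≤ η * r k := by
  rw [← dist_eq_norm]
  exact Metric.mem_closedBall.1 (Finset.mem_filter.1 hp).2

lemma IsConstruction.eventually_le_card_childrenNear (hd : 3 ≤ d)
    (hr : IsScaleSequence (scaleBound d) r) (hc : IsConstruction r children)
    (hratio : Tendsto (fun n => r (n + 1) / r n) atTop (𝓝 0)) {w : Space d} {η : ℝ} (hη : 0 < η)
    (hw : ‖w‖ + η ≤ 1) :
    ∀ᶠ k in atTop, ∀ z ∈ centers children k,
      (η / 2) ^ d / 2 * (r k / r (k + 1)) ^ (d - 2) ≤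
        ((childrenNear r children w η k z).card : ℝ) := by
  have he := tendsto_enlargement hd hratio
  have he' : Tendsto (fun k => (1 + enlargement d (r k) (r (k + 1))) ^ d) atTop (𝓝 1) := by
    simpa using (he.const_add 1).pow d
  have hpos : 0 < (η / 2) ^ d / 2 := by positivity
  filter_upwards [he.eventually_le_const (half_pos hη),
    he'.eventually_le_const (lt_add_of_pos_right 1 hpos)] with k h1 h2 z hz
  exact (hc k z hz).le_card_filter (by omega) (hr.pos k) (hr.pos (k + 1)) hw h1 h2

lemma IsLimitMeasure.measure_biUnion_childrenNear (hd : 3 ≤ d)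
    (hr : IsScaleSequence (scaleBound d) r) (hc : IsConstruction r children)
    {μ : Measure (Space d)} (hμ : IsLimitMeasure r children μ) {w : Space d} {η : ℝ} {k : ℕ}
    {z : Space d} (hz : z ∈ centers children k) :
    μ.real (⋃ p ∈ childrenNear r children w η k z, cell r (k + 1) p) =
      (childrenNear r children w η k z).card * (kappa d * r (k + 1) ^ (d - 2)) := by
  have : IsFiniteMeasure μ := hμ.1
  have hmem {p} (hp : p ∈ childrenNear r children w η k z) : p ∈ centers children (k + 1) :=
    mem_centers_succ.2 ⟨z, hz, childrenNear_subset _ _ _ _ hp⟩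
  rw [measureReal_biUnion_finset]
  · rw [Finset.sum_congr rfl fun p hp => hμ.measure_cell hd hr hc (hmem hp), Finset.sum_const,
      nsmul_eq_mul]
  · intro p hp q hq hne
    refine Set.disjoint_left.2 fun y hy hy' => hne ?_
    exact hc.eq_of_mem_cell hd hr (hmem hp) (hmem hq) hy hy'
  · exact fun p _ => Metric.isClosed_closedBall.measurableSet

open scoped Classical in
/-- The centres of generation `m + n` for which neither they nor any ancestor of generation
`m + 1, …, m + n` lies near the prescribed relative position `w` in its parent ball. -/
def avoidingCenters (r : ℕ → ℝ) (children : ℕ → Space d → Finset (Space d)) (w : Space d) (η : ℝ)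
    (m : ℕ) : ℕ → Finset (Space d)
  | 0 => centers children m
  | n + 1 => (avoidingCenters r children w η m n).biUnion fun z =>
      children (m + n) z \ childrenNear r children w η (m + n) z

lemma avoidingCenters_subset (w : Space d) (η : ℝ) (m n : ℕ) :
    avoidingCenters r children w η m n ⊆ centers children (m + n) := by
  induction n with
  | zero => exact subset_rfl
  | succ n ih =>
    intro p hp
    obtain ⟨z, hz, hp⟩ := Finset.mem_biUnion.1 hp
    exact mem_centers_succ.2 ⟨z, ih hz, (Finset.mem_sdiff.1 hp).1⟩

/-- Each generation keeps at most the fraction `1 - c` of the avoiding centres. -/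
lemma IsConstruction.card_avoidingCenters_le (hd : 3 ≤ d)
    (hr : IsScaleSequence (scaleBound d) r) (hc : IsConstruction r children) {w : Space d}
    {η c : ℝ} (hc1 : c ≤ 1) {m : ℕ}
    (hcard : ∀ k ≥ m, ∀ z ∈ centers children k, c * (r k / r (k + 1)) ^ (d - 2) ≤
        ((childrenNear r children w η k z).card : ℝ)) (n : ℕ) :
    ((avoidingCenters r children w η m n).card : ℝ) * r (m + n) ^ (d - 2) ≤ (1 - c) ^ n := by
  induction n with
  | zero =>
    rw [pow_zero, mul_comm]
    exact (hc.card_centers hd hr m).le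
  | succ n ih =>
    have h1 := hr.pos (m + n)
    have h2 := hr.pos (m + n + 1)
    have hle : ((avoidingCenters r children w η m (n + 1)).card : ℝ) ≤
        (avoidingCenters r children w η m n).card *
          ((1 - c) * (r (m + n) / r (m + n + 1)) ^ (d - 2)) := by
      calc ((avoidingCenters r children w η m (n + 1)).card : ℝ)
          ≤ ∑ z ∈ avoidingCenters r children w η m n,
            ((children (m + n) z \ childrenNear r children w η (m + n) z).card : ℝ) := by
            exact_mod_cast Finset.card_biUnion_le
        _ ≤ ∑ z ∈ avoidingCenters r children w η m n,
            (1 - c) * (r (m + n) / r (m + n + 1)) ^ (d - 2) := by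
            refine Finset.sum_le_sum fun z hz => ?_
            have hz' := avoidingCenters_subset w η m n hz
            have h3 := hcard (m + n) (Nat.le_add_right _ _) z hz'
            have h4 := (hc (m + n) z hz').card_eq
            rw [Finset.cast_card_sdiff (childrenNear_subset _ _ _ _), h4]
            linarith
        _ = _ := by rw [Finset.sum_const, nsmul_eq_mul]
    calc ((avoidingCenters r children w η m (n + 1)).card : ℝ) * r (m + (n + 1)) ^ (d - 2)
        ≤ (avoidingCenters r children w η m n).card *
          ((1 - c) * (r (m + n) / r (m + n + 1)) ^ (d - 2)) * r (m + n + 1) ^ (d - 2) := by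
          rw [← add_assoc]
          gcongr
      _ = (1 - c) * ((avoidingCenters r children w η m n).card * r (m + n) ^ (d - 2)) := by
          rw [div_pow]
          field_simp
      _ ≤ (1 - c) * (1 - c) ^ n := mul_le_mul_of_nonneg_left ih (by linarith)
      _ = (1 - c) ^ (n + 1) := (pow_succ' _ _).symm

lemma IsLimitMeasure.measure_avoiding (hd : 3 ≤ d) (hr : IsScaleSequence (scaleBound d) r)
    (hc : IsConstruction r children) {μ : Measure (Space d)} (hμ : IsLimitMeasure r children μ)
    {w : Space d} {η c : ℝ} (hc0 : 0 < c) (hc1 : c ≤ 1) {m : ℕ}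
    (hcard : ∀ k ≥ m, ∀ z ∈ centers children k, c * (r k / r (k + 1)) ^ (d - 2) ≤
        ((childrenNear r children w η k z).card : ℝ)) :
    μ (⋂ n, ⋃ z ∈ avoidingCenters r children w η m n, cell r (m + n) z) = 0 := by
  have : IsFiniteMeasure μ := hμ.1
  rw [← measureReal_eq_zero_iff]
  refine le_antisymm ?_ measureReal_nonneg
  have hlim : Tendsto (fun n : ℕ => kappa d * (1 - c) ^ n) atTop (𝓝 0) := by
    simpa using (tendsto_pow_atTop_nhds_zero_of_lt_one (by linarith : 0 ≤ 1 - c)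
      (by linarith)).const_mul (kappa d)
  refine ge_of_tendsto' hlim fun n => ?_
  calc μ.real (⋂ n, ⋃ z ∈ avoidingCenters r children w η m n, cell r (m + n) z)
      ≤ μ.real (⋃ z ∈ avoidingCenters r children w η m n, cell r (m + n) z) :=
        measureReal_mono (Set.iInter_subset _ n) (measure_ne_top _ _)
    _ ≤ ∑ z ∈ avoidingCenters r children w η m n, μ.real (cell r (m + n) z) :=
        measureReal_biUnion_finset_le _ _
    _ = kappa d * ((avoidingCenters r children w η m n).card * r (m + n) ^ (d - 2)) := by
        rw [Finset.sum_congr rfl fun z hz =>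
          hμ.measure_cell hd hr hc (avoidingCenters_subset w η m n hz), Finset.sum_const,
          nsmul_eq_mul]
        ring
    _ ≤ kappa d * (1 - c) ^ n := mul_le_mul_of_nonneg_left
        (hc.card_avoidingCenters_le hd hr hc1 hcard n) (kappa_pos d).le

/-- Almost every point occupies infinitely often, up to `η`, the relative position `w` in the ball
of the construction that contains it: the proportion of children near that position is bounded
below, so avoiding it in all generations from some `m` on has measure zero. -/
theorem IsLimitMeasure.ae_frequently (hd : 3 ≤ d) (hr : IsScaleSequence (scaleBound d) r)
    (hratio : Tendsto (fun n => r (n + 1) / r n) atTop (𝓝 0)) (hc : IsConstruction r children)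
    {μ : Measure (Space d)} (hμ : IsLimitMeasure r children μ)
    {w : Space d} {η : ℝ} (hη : 0 < η) (hw : ‖w‖ + η ≤ 1) :
    ∀ᵐ x ∂μ, ∃ᶠ k in atTop, ∃ z ∈ centers children k, ∃ p ∈ childrenNear r children w η k z,
      x ∈ cell r (k + 1) p := by
  have hη1 : η ≤ 1 := by linarith [norm_nonneg w]
  obtain ⟨K, hK⟩ := eventually_atTop.1
    (hc.eventually_le_card_childrenNear hd hr hratio hη hw)
  have hc1 : (η / 2) ^ d / 2 ≤ 1 := by
    have : (η / 2) ^ d ≤ 1 := pow_le_one₀ (by positivity) (by linarith)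
    linarith
  have hnull : ∀ᵐ x ∂μ, ∀ m, x ∉ ⋂ n, ⋃ z ∈ avoidingCenters r children w η (max m K) n,
      cell r (max m K + n) z := by
    rw [ae_all_iff]
    intro m
    exact measure_eq_zero_iff_ae_notMem.1 (hμ.measure_avoiding hd hr hc (by positivity) hc1
      fun k hk => hK k ((le_max_right m K).trans hk))
  filter_upwards [ae_all_iff.2 (hμ.ae_mem_cells hd hr hc), hnull] with x hx hxn
  rw [frequently_atTop]
  intro a
  by_contra! hno
  refine hxn a (Set.mem_iInter.2 fun n => ?_)
  induction n with
  | zero => exact hx (max a K)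
  | succ n ih =>
    obtain ⟨z, hz, hxz⟩ := Set.mem_iUnion₂.1 ih
    have hz' := avoidingCenters_subset w η _ n hz
    obtain ⟨p, hp, hxp⟩ := Set.mem_iUnion₂.1 (hx (max a K + n + 1))
    obtain ⟨u, hu, hpu⟩ := mem_centers_succ.1 hp
    obtain rfl := hc.eq_of_mem_cell hd hr hu hz' (hc.cell_subset_cell hd hr hu hpu hxp) hxz
    refine Set.mem_iUnion₂.2 ⟨p, Finset.mem_biUnion.2 ⟨u, hz, Finset.mem_sdiff.2 ⟨hpu, ?_⟩⟩, hxp⟩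
    intro hnear
    exact hno (max a K + n) ((le_max_left a K).trans (Nat.le_add_right _ _)) u hu p hnear hxp

end Limit

/-! ### Directions and truncated integrals -/

section Direction

variable {E : Type*} [NormedAddCommGroup E]

lemma norm_inv_norm_smul_sub_le [NormedSpace ℝ E] {D ω : E} {T s : ℝ} (hT : 0 < T)
    (hD : D ≠ 0) (hω : ‖ω‖ = 1) (h : ‖D - T • ω‖ ≤ s * T) : ‖‖D‖⁻¹ • D - ω‖ ≤ 2 * s := by
  have hD' : 0 < ‖D‖ := norm_pos_iff.2 hD
  have h1 : ‖‖D‖⁻¹ • D - T⁻¹ • D‖ ≤ s := by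
    rw [← sub_smul, norm_smul, Real.norm_eq_abs]
    have e : |‖D‖⁻¹ - T⁻¹| * ‖D‖ = |T - ‖D‖| / T := by
      rw [← abs_of_pos hD', ← abs_mul, abs_of_pos hD', ← abs_of_pos hT, ← abs_div, abs_of_pos hT]
      congr 1
      field_simp
    rw [e, div_le_iff₀ hT]
    refine le_trans ?_ h
    have h2 := abs_norm_sub_norm_le D (T • ω)
    rwa [norm_smul, hω, mul_one, Real.norm_of_nonneg hT.le, abs_sub_comm] at h2
  have h2 : ‖T⁻¹ • D - ω‖ ≤ s := by
    have e : T⁻¹ • D - ω = T⁻¹ • (D - T • ω) := by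
      rw [smul_sub, smul_smul, inv_mul_cancel₀ hT.ne', one_smul]
    rw [e, norm_smul, norm_inv, Real.norm_of_nonneg hT.le, inv_mul_le_iff₀ hT]
    linarith
  linarith [norm_sub_le_norm_sub_add_norm_sub (‖D‖⁻¹ • D) (T⁻¹ • D) ω]

/-- If two points of a slightly enlarged ball of radius `R` are almost `2 R` apart, they are almost
antipodal by the parallelogram law, so the direction from one to the other is almost radial. -/
lemma norm_direction_sub_le [InnerProductSpace ℝ E] {a b ω : E} {R η : ℝ} (hR : 0 < R)
    (hη : 0 < η) (hη' : η ≤ 1 / 10) (hω : ‖ω‖ = 1) (ha : ‖a‖ ≤ (1 + η) * R)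
    (hb : ‖b‖ ≤ (1 + η) * R) (haω : ‖a - R • ω‖ ≤ 3 * η * R) (hab : (2 - 7 * η) * R < ‖a - b‖) :
    ‖‖a - b‖⁻¹ • (a - b) - ω‖ ≤ 12 * √η := by
  have hpos : 0 < (2 - 7 * η) * R := mul_pos (by linarith) hR
  have hne : a - b ≠ 0 := norm_pos_iff.1 (hpos.trans hab)
  have hs := Real.sqrt_nonneg η
  have hss := Real.sq_sqrt hη.le
  have hηs : η ≤ √η := Real.le_sqrt_of_sq_le (by nlinarith)
  -- `4 (1 + η) ^ 2 - (2 - 7 η) ^ 2 ≤ 36 η`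
  have hsum : ‖a + b‖ ≤ 6 * √η * R := by
    refine le_of_sq_le_sq ?_ (by positivity)
    have hpar := parallelogram_law_with_norm ℝ a b
    have h1 : ‖a‖ ^ 2 ≤ ((1 + η) * R) ^ 2 := by gcongr
    have h2 : ‖b‖ ^ 2 ≤ ((1 + η) * R) ^ 2 := by gcongr
    have h3 : ((2 - 7 * η) * R) ^ 2 ≤ ‖a - b‖ ^ 2 := by gcongr
    have h4 : (6 * √η * R) ^ 2 = 36 * η * R ^ 2 := by rw [mul_pow, mul_pow, hss]; ring
    nlinarith [mul_nonneg (sq_nonneg η) (sq_nonneg R)]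
  have h : ‖(a - b) - (2 * R) • ω‖ ≤ 6 * √η * (2 * R) := by
    have e : (a - b) - (2 * R) • ω = (2 : ℝ) • (a - R • ω) - (a + b) := by
      rw [smul_sub, smul_smul, two_smul]; abel
    rw [e]
    refine (norm_sub_le _ _).trans ?_
    rw [norm_smul, Real.norm_ofNat]
    nlinarith
  exact (norm_inv_norm_smul_sub_le (by positivity) hne hω h).trans (by linarith)

end Direction

section Truncation

variable {d : ℕ} {Ω : Space d → ℝ} {μ : Measure (Space d)}

lemma IsHolderOnSphere.continuousOn {α : ℝ} (hα : 0 < α) (hΩ : IsHolderOnSphere α Ω) :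
    ContinuousOn Ω (Metric.sphere 0 1) := by
  obtain ⟨C, hC⟩ := hΩ
  intro ω hω
  rw [ContinuousWithinAt, tendsto_iff_norm_sub_tendsto_zero]
  have hlim : Tendsto (fun ξ => C * ‖ξ - ω‖ ^ α) (𝓝[Metric.sphere 0 1] ω) (𝓝 0) := by
    have h1 : Tendsto (fun ξ : Space d => ‖ξ - ω‖) (𝓝[Metric.sphere 0 1] ω) (𝓝 0) := by
      have : Continuous fun ξ : Space d => ‖ξ - ω‖ := by fun_prop
      simpa using (this.tendsto ω).mono_left nhdsWithin_le_nhds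
    simpa [Real.zero_rpow hα.ne'] using (h1.rpow_const (p := α) (Or.inr hα.le)).const_mul C
  refine squeeze_zero' (Eventually.of_forall fun _ => norm_nonneg _) ?_ hlim
  filter_upwards [self_mem_nhdsWithin] with ξ hξ
  exact hC ξ hξ ω hω

lemma inv_norm_smul_mem_sphere {v : Space d} (hv : v ≠ 0) :
    ‖v‖⁻¹ • v ∈ Metric.sphere (0 : Space d) 1 := by
  rw [mem_sphere_zero_iff_norm, norm_smul, norm_inv, norm_norm,
    inv_mul_cancel₀ (norm_ne_zero_iff.2 hv)]

lemma measurableSet_truncation (x : Space d) (ε : ℝ) : MeasurableSet {y | ε < ‖x - y‖} :=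
  (isOpen_lt (by fun_prop) (by fun_prop)).measurableSet

lemma integrableOn_kernel [IsFiniteMeasure μ] (hΩ : ContinuousOn Ω (Metric.sphere 0 1))
    (x : Space d) {ε : ℝ} (hε : 0 < ε) :
    IntegrableOn (fun y => Ω (‖x - y‖⁻¹ • (x - y)) / ‖x - y‖ ^ (d - 2)) {y | ε < ‖x - y‖} μ := by
  obtain ⟨M, hM⟩ := (isCompact_sphere (0 : Space d) 1).exists_bound_of_continuousOn hΩ
  have hne {y : Space d} (hy : ε < ‖x - y‖) : ‖x - y‖ ≠ 0 := (hε.trans hy).ne'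
  have hne' {y : Space d} (hy : ε < ‖x - y‖) : x - y ≠ 0 := norm_ne_zero_iff.1 (hne hy)
  refine Integrable.of_bound ?_ (M / ε ^ (d - 2)) ?_
  · suffices h : ContinuousOn (fun y => Ω (‖x - y‖⁻¹ • (x - y)) / ‖x - y‖ ^ (d - 2))
        {y | ε < ‖x - y‖} from h.aestronglyMeasurable (measurableSet_truncation x ε)
    refine ContinuousOn.div ?_ (by fun_prop) fun y hy => pow_ne_zero _ (hne hy)
    refine hΩ.comp ?_ fun y hy => inv_norm_smul_mem_sphere (hne' hy)
    exact ContinuousOn.smul (ContinuousOn.inv₀ (by fun_prop) fun y hy => hne hy) (by fun_prop)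
  · filter_upwards [ae_restrict_mem (measurableSet_truncation x ε)] with y hy
    have hy' : ε < ‖x - y‖ := hy
    rw [norm_div, norm_pow, norm_norm]
    have h1 := hM _ (inv_norm_smul_mem_sphere (hne' hy'))
    have h2 := (norm_nonneg _).trans h1
    gcongr

lemma truncated_neg (x : Space d) (ε : ℝ) :
    truncated (-Ω) μ x ε = -truncated Ω μ x ε := by
  rw [truncated, truncated, ← integral_neg]
  simp only [Pi.neg_apply, neg_div]

lemma le_truncated_sub_truncated [IsFiniteMeasure μ] (hΩ : ContinuousOn Ω (Metric.sphere 0 1))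
    {x : Space d} {s t c : ℝ} (hs : 0 < s) (hst : s ≤ t) (hc : 0 ≤ c)
    (h : ∀ᵐ y ∂μ, s < ‖x - y‖ → ‖x - y‖ ≤ t → c ≤ Ω (‖x - y‖⁻¹ • (x - y))) :
    c / t ^ (d - 2) * μ.real {y | s < ‖x - y‖ ∧ ‖x - y‖ ≤ t} ≤
      truncated Ω μ x s - truncated Ω μ x t := by
  have hsub : {y | t < ‖x - y‖} ⊆ {y | s < ‖x - y‖} := fun y hy => hst.trans_lt hy
  have hint := integrableOn_kernel (μ := μ) hΩ x hs
  have hset : {y | s < ‖x - y‖} \ {y | t < ‖x - y‖} = {y | s < ‖x - y‖ ∧ ‖x - y‖ ≤ t} := by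
    ext y
    exact and_congr_right fun _ => not_lt (a := t) (b := ‖x - y‖)
  have hmeas := (measurableSet_truncation x s).diff (measurableSet_truncation x t)
  rw [truncated, truncated, ← setIntegral_sdiff (measurableSet_truncation x t) hint hsub, hset]
  rw [hset] at hmeas
  have hconst : c / t ^ (d - 2) * μ.real {y | s < ‖x - y‖ ∧ ‖x - y‖ ≤ t} =
      ∫ _ in {y | s < ‖x - y‖ ∧ ‖x - y‖ ≤ t}, c / t ^ (d - 2) ∂μ := by
    rw [setIntegral_const, smul_eq_mul, mul_comm]
  rw [hconst]
  refine setIntegral_mono_on_ae (integrableOn_const (measure_ne_top _ _))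
    (hint.mono_set fun y hy => hy.1) hmeas ?_
  filter_upwards [h] with y hy hys
  have h1 := hy hys.1 hys.2
  have h2 : 0 < ‖x - y‖ := hs.trans hys.1
  have h3 := hc.trans h1
  gcongr
  exact hys.2

end Truncation

/-! ### Oscillation of the truncated integrals -/

section Oscillation

variable {d : ℕ} {r : ℕ → ℝ} {children : ℕ → Space d → Finset (Space d)}

/-- If `x` lies near the pole `z + R ω₀` of the ball of centre `z` and radius `R = r k`, then the
points of the annulus `(2 - 7 η) R < |x - y| ≤ 5 R` that carry mass lie near the opposite pole and
are seen from `x` in directions close to `ω₀`, where `Ω ≥ c`. As a definite proportion of the mass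
of the ball is near that opposite pole, the truncated integral changes by a definite amount
between the two radii. -/
lemma IsLimitMeasure.le_truncated_sub_truncated (hd : 3 ≤ d)
    (hr : IsScaleSequence (scaleBound d) r) (hc : IsConstruction r children)
    {μ : Measure (Space d)} (hμ : IsLimitMeasure r children μ) {Ω : Space d → ℝ}
    (hΩ : ContinuousOn Ω (Metric.sphere 0 1)) {ω₀ : Space d} (hω₀ : ‖ω₀‖ = 1) {η c b : ℝ}
    (hη : 0 < η) (hη' : η ≤ 1 / 10) (hc0 : 0 ≤ c)
    (hpos : ∀ ω ∈ Metric.sphere (0 : Space d) 1, ‖ω - ω₀‖ ≤ 12 * √η → c ≤ Ω ω) {k : ℕ}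
    (hsmall : 2 * r (k + 1) ≤ η * r k) (he : enlargement d (r k) (r (k + 1)) ≤ η)
    {x z p : Space d} (hz : z ∈ centers children k)
    (hcard : b * (r k / r (k + 1)) ^ (d - 2) ≤
      ((childrenNear r children (-((1 - η) • ω₀)) η k z).card : ℝ))
    (hp : p ∈ childrenNear r children ((1 - η) • ω₀) η k z) (hx : x ∈ cell r (k + 1) p) :
    c / 5 ^ (d - 2) * (b * kappa d) ≤
      truncated Ω μ x ((2 - 7 * η) * r k) - truncated Ω μ x (5 * r k) := by
  have : IsFiniteMeasure μ := hμ.1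
  have hk := hr.pos k
  have hk' := hr.pos (k + 1)
  have hκ := kappa_pos d
  have hnear {w q y : Space d} (hq : q ∈ childrenNear r children w η k z)
      (hy : y ∈ cell r (k + 1) q) : ‖(y - z) - r k • w‖ ≤ 2 * η * r k := by
    have h1 := norm_sub_le_of_mem_childrenNear hq
    have h2 := mem_cell.1 hy
    have h3 := norm_add_le (y - q) (q - (z + r k • w))
    rw [show y - q + (q - (z + r k • w)) = (y - z) - r k • w by abel] at h3
    linarith
  have hball {u q y : Space d} (hu : u ∈ centers children k) (hq : q ∈ children k u)
      (hy : y ∈ cell r (k + 1) q) : ‖y - u‖ ≤ (1 + η) * r k := by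
    have h := hc.cell_subset_closedBall hd hr hu hq hy
    rw [Metric.mem_closedBall, dist_eq_norm] at h
    exact h.trans (by gcongr)
  have hpole (v : Space d) : ‖v - r k • ω₀‖ ≤ ‖v - r k • ((1 - η) • ω₀)‖ + η * r k := by
    have e : v - r k • ω₀ = (v - r k • ((1 - η) • ω₀)) - (η * r k) • ω₀ := by
      module
    rw [e]
    refine (norm_sub_le _ _).trans ?_
    rw [norm_smul, hω₀, mul_one, Real.norm_of_nonneg (by positivity)]
  have hxz := hball hz (childrenNear_subset _ _ _ _ hp) hx
  have hxω : ‖(x - z) - r k • ω₀‖ ≤ 3 * η * r k := by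
    linarith [hpole (x - z), hnear hp hx]
  -- Mass in the annulus: all points near the opposite pole belong to it.
  have hmass : b * kappa d * r k ^ (d - 2) ≤
      μ.real {y | (2 - 7 * η) * r k < ‖x - y‖ ∧ ‖x - y‖ ≤ 5 * r k} := by
    calc b * kappa d * r k ^ (d - 2)
        = b * (r k / r (k + 1)) ^ (d - 2) * (kappa d * r (k + 1) ^ (d - 2)) := by
          rw [div_pow]
          field_simp
      _ ≤ (childrenNear r children (-((1 - η) • ω₀)) η k z).card *
          (kappa d * r (k + 1) ^ (d - 2)) := by gcongr
      _ = μ.real (⋃ q ∈ childrenNear r children (-((1 - η) • ω₀)) η k z, cell r (k + 1) q) :=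
          (hμ.measure_biUnion_childrenNear hd hr hc hz).symm
      _ ≤ _ := by
          refine measureReal_mono (Set.iUnion₂_subset fun q hq y hy => ?_) (measure_ne_top _ _)
          have hyz := hball hz (childrenNear_subset _ _ _ _ hq) hy
          have h1 : ‖(z - y) - r k • ω₀‖ ≤ 3 * η * r k := by
            have h2 := hnear hq hy
            rw [← norm_neg, show -((y - z) - r k • -((1 - η) • ω₀)) =
              (z - y) - r k • ((1 - η) • ω₀) by module] at h2
            linarith [hpole (z - y)]
          constructor
          · have h2 := norm_sub_norm_le ((2 * r k) • ω₀) ((2 * r k) • ω₀ - (x - y))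
            rw [sub_sub_cancel, norm_smul, hω₀, Real.norm_of_nonneg (by positivity)] at h2
            have h3 := norm_add_le ((x - z) - r k • ω₀) ((z - y) - r k • ω₀)
            rw [← norm_neg, show -((x - z) - r k • ω₀ + ((z - y) - r k • ω₀)) =
              (2 * r k) • ω₀ - (x - y) by module] at h3
            have := mul_pos hη hk
            linarith
          · have h2 := norm_sub_le_norm_sub_add_norm_sub x z y
            rw [norm_sub_rev z y] at h2
            nlinarith
  have hdir : ∀ᵐ y ∂μ, (2 - 7 * η) * r k < ‖x - y‖ → ‖x - y‖ ≤ 5 * r k →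
      c ≤ Ω (‖x - y‖⁻¹ • (x - y)) := by
    filter_upwards [hμ.ae_mem_cells hd hr hc (k + 1)] with y hy h1 h2
    obtain ⟨q, hq, hyq⟩ := Set.mem_iUnion₂.1 hy
    obtain ⟨u, hu, hqu⟩ := mem_centers_succ.1 hq
    have hyu := hball hu hqu hyq
    -- Points in another ball of the generation are more than `5 r k` away from `x`.
    obtain rfl : u = z := by
      by_contra hne
      have h3 := hc.le_norm_sub hd hr k hu hz hne
      have h4 := norm_add₃_le (a := u - y) (b := y - x) (c := x - z)
      rw [show u - y + (y - x) + (x - z) = u - z by abel, norm_sub_rev u y,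
        norm_sub_rev y x] at h4
      nlinarith
    have hne : x - y ≠ 0 := norm_pos_iff.1 ((mul_pos (by linarith) hk).trans h1)
    refine hpos _ (inv_norm_smul_mem_sphere hne) ?_
    rw [← sub_sub_sub_cancel_right x y u] at h1 ⊢
    exact norm_direction_sub_le hk hη hη' hω₀ hxz hyu hxω h1
  calc c / 5 ^ (d - 2) * (b * kappa d)
      = c / (5 * r k) ^ (d - 2) * (b * kappa d * r k ^ (d - 2)) := by
        rw [mul_pow]
        field_simp
    _ ≤ c / (5 * r k) ^ (d - 2) *
        μ.real {y | (2 - 7 * η) * r k < ‖x - y‖ ∧ ‖x - y‖ ≤ 5 * r k} := by gcongr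
    _ ≤ _ := CantorPV.le_truncated_sub_truncated hΩ (mul_pos (by linarith) hk)
        (by nlinarith) hc0 hdir

/-- Divergence of the truncated integrals when `Ω` is positive somewhere on the sphere. -/
theorem IsLimitMeasure.ae_not_tendsto_truncated (hd : 3 ≤ d)
    (hr : IsScaleSequence (scaleBound d) r)
    (hratio : Tendsto (fun n => r (n + 1) / r n) atTop (𝓝 0)) (hc : IsConstruction r children)
    {μ : Measure (Space d)} (hμ : IsLimitMeasure r children μ) {Ω : Space d → ℝ}
    (hΩ : ContinuousOn Ω (Metric.sphere 0 1)) {ω₀ : Space d}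
    (hω₀ : ω₀ ∈ Metric.sphere (0 : Space d) 1) (hpos : 0 < Ω ω₀) :
    ∀ᵐ x ∂μ, ¬ ∃ L : ℝ, Tendsto (fun ε => truncated Ω μ x ε) (𝓝[>] 0) (𝓝 L) := by
  have hnorm : ‖ω₀‖ = 1 := mem_sphere_zero_iff_norm.1 hω₀
  obtain ⟨δ, hδ, hball⟩ := Metric.continuousOn_iff.1 hΩ ω₀ hω₀ (Ω ω₀ / 2) (by positivity)
  -- With this choice `η ≤ 1 / 10` and `12 √η < δ`.
  set η : ℝ := min (1 / 10) ((δ / 13) ^ 2) with hηdef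
  have hη : 0 < η := by positivity
  have hη' : η ≤ 1 / 10 := min_le_left _ _
  have hηδ : 12 * √η < δ := by
    have : √η ≤ δ / 13 := (Real.sqrt_le_left (by positivity)).2 (min_le_right _ _)
    linarith
  have hΩpos : ∀ ω ∈ Metric.sphere (0 : Space d) 1, ‖ω - ω₀‖ ≤ 12 * √η → Ω ω₀ / 2 ≤ Ω ω := by
    intro ω hω hle
    have h := hball ω hω (by rw [dist_eq_norm]; linarith)
    rw [Real.dist_eq, abs_lt] at h
    linarith
  have hw : ‖(1 - η) • ω₀‖ + η ≤ 1 := by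
    rw [norm_smul, hnorm, Real.norm_of_nonneg (by linarith)]
    linarith
  have hb : 0 < (η / 2) ^ d / 2 := by positivity
  have hgap : 0 < Ω ω₀ / 2 / 5 ^ (d - 2) * ((η / 2) ^ d / 2 * kappa d) := by
    have := kappa_pos d
    positivity
  filter_upwards [hμ.ae_frequently hd hr hratio hc hη hw] with x hx
  rintro ⟨L, hL⟩
  -- If the limit exists, the difference along `(2 - 7 η) r k` and `5 r k` tends to `0`.
  have hlim {a : ℝ} (ha : 0 < a) : Tendsto (fun k => truncated Ω μ x (a * r k)) atTop (𝓝 L) := by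
    refine hL.comp (tendsto_nhdsWithin_iff.2 ⟨?_, Eventually.of_forall fun k =>
      mul_pos ha (hr.pos k)⟩)
    simpa using hr.tendsto_zero.const_mul a
  have hdiff := (hlim (show 0 < 2 - 7 * η by linarith)).sub (hlim (show (0 : ℝ) < 5 by norm_num))
  rw [sub_self] at hdiff
  have hsmall : ∀ᶠ k in atTop, 2 * r (k + 1) ≤ η * r k := by
    filter_upwards [hratio.eventually_le_const (half_pos hη)] with k hk
    rw [div_le_iff₀ (hr.pos k)] at hk
    linarith
  obtain ⟨k, ⟨z, hz, p, hp, hxp⟩, hlt, h1, h2, h3⟩ := (hx.and_eventually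
    ((hdiff.eventually_lt_const hgap).and (hsmall.and
      (((tendsto_enlargement hd hratio).eventually_le_const hη).and
        (hc.eventually_le_card_childrenNear hd hr hratio hη
          (w := -((1 - η) • ω₀)) (by rwa [norm_neg])))))).exists
  exact hlt.not_ge (hμ.le_truncated_sub_truncated hd hr hc hΩ hnorm hη hη' (by positivity) hΩpos
    h1 h2 hz (h3 z hz) hp hxp)

end Oscillation

end CantorPV

end

theorem theorem5p1 (d : ℕ) (hd : 3 ≤ d) :
    ∃ B : ℝ, 1 < B ∧ ∀ r : ℕ → ℝ, CantorPV.IsScaleSequence B r →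
      Tendsto (fun n => r (n + 1) / r n) atTop (𝓝 0) →
      (∃ children : ℕ → CantorPV.Space d → Finset (CantorPV.Space d),
        CantorPV.IsConstruction r children) ∧
      ∀ children : ℕ → CantorPV.Space d → Finset (CantorPV.Space d),
        CantorPV.IsConstruction r children →
        (∃ μ : Measure (CantorPV.Space d), CantorPV.IsLimitMeasure r children μ) ∧
        ∀ μ : Measure (CantorPV.Space d), CantorPV.IsLimitMeasure r children μ →
          ∀ (α : ℝ) (Ω : CantorPV.Space d → ℝ), 0 < α → α ≤ 1 →
            CantorPV.IsHolderOnSphere α Ω →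
            (∃ ω ∈ Metric.sphere (0 : CantorPV.Space d) 1, Ω ω ≠ 0) →
            ∀ᵐ x ∂μ, ¬ ∃ L : ℝ,
              Tendsto (fun ε => CantorPV.truncated Ω μ x ε) (𝓝[>] 0) (𝓝 L) := by
  refine ⟨CantorPV.scaleBound d, by linarith [CantorPV.two_le_scaleBound d],
    fun r hr hratio => ⟨CantorPV.exists_isConstruction (by omega) hr, fun children hc =>
      ⟨hc.exists_isLimitMeasure hd hr, ?_⟩⟩⟩
  rintro μ hμ α Ω hα - hΩ ⟨ω₀, hω₀, hne⟩
  have hcont := hΩ.continuousOn hα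
  rcases hne.lt_or_gt with h | h
  · filter_upwards [hμ.ae_not_tendsto_truncated hd hr hratio hc hcont.neg hω₀
      (by simpa using h)] with x hx
    rintro ⟨L, hL⟩
    refine hx ⟨-L, ?_⟩
    simpa only [CantorPV.truncated_neg] using hL.neg
  · exact hμ.ae_not_tendsto_truncated hd hr hratio hc hcont hω₀ h
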